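/- Let $\mathbb{D}=\{z\in\mathbb{C}:|z|<1\}$. For a harmonic mapping $f:\mathbb{D}\to\mathbb{C}$ write $J_f=|f_z|^2-|f_{\overline z}|^2$ for its Jacobian. Call $f$ sense-preserving if $J_f>0$ in $\mathbb{D}$, and uniformly locally univalent (ULU) if there is a constant $\rho>0$ such that, for every $a\in\mathbb{D}$, $f$ is injective on the hyperbolic disk $\left\{z\in\mathbb{D}:\left|\frac{z-a}{1-\overline{a}z}\right|<\tanh\rho\right\}$. Let $\mathcal{B}^*_H(1)$ be the class of harmonic mappings $f$ in $\mathbb{D}$ with $\sup_{z\in\mathbb{D}}(1-|z|^2)\sqrt{|J_f(z)|}<\infty$. Theorem. Let $H$ and $G$ be analytic in $\mathbb{D}$ and suppose that $F=H+\overline{G}$ is sense-preserving and ULU in $\mathbb{D}$. Let $\varepsilon\in\overline{\mathbb{D}}$. Then $H'+\varepsilon G'$ has an analytic logarithm in $\mathbb{D}$. Moreover, let $h_\varepsilon=\log(H'+\varepsilon G')$ be any such logarithm, that is, any analytic function in $\mathbb{D}$ with $e^{h_\varepsilon}=H'+\varepsilon G'$, and let $g_\varepsilon$ be any analytic function in $\mathbb{D}$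 whose dilatation relative to $h_\varepsilon$ is bounded, that is, $g_\varepsilon'=\omega h_\varepsilon'$ in $\mathbb{D}$ for some bounded function $\omega:\mathbb{D}\to\mathbb{C}$. Then the harmonic mapping $f_\varepsilon=h_\varepsilon+\overline{g_\varepsilon}$ belongs to $\mathcal{B}^*_H(1)$. -/

import Mathlib

open Complex Metric
open scoped ComplexConjugate

namespace HarmonicBloch

/-- The Wirtinger derivative `f_z = (f_x - i f_y) / 2` of a (real differentiable) map. -/
noncomputable def dz (f : ℂ → ℂ) (z : ℂ) : ℂ :=
  (fderiv ℝ f z 1 - I * fderiv ℝ f z I) / 2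

/-- The Wirtinger derivative `f_{z̄} = (f_x + i f_y) / 2` of a (real differentiable) map. -/
noncomputable def dzbar (f : ℂ → ℂ) (z : ℂ) : ℂ :=
  (fderiv ℝ f z 1 + I * fderiv ℝ f z I) / 2

/-- The Jacobian `J_f = |f_z|² - |f_{z̄}|²`. -/
noncomputable def jacobian (f : ℂ → ℂ) (z : ℂ) : ℝ :=
  ‖dz f z‖ ^ 2 - ‖dzbar f z‖ ^ 2

/-- A complex-valued harmonic mapping of the open unit disk. -/
def IsHarmonicMapping (f : ℂ → ℂ) : Prop :=
  InnerProductSpace.HarmonicOnNhd f (ball (0 : ℂ) 1)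

/-- A harmonic mapping of the disk is (locally univalent and) sense-preserving when its
Jacobian is positive throughout the disk. -/
def SensePreserving (f : ℂ → ℂ) : Prop :=
  ∀ z ∈ ball (0 : ℂ) 1, 0 < jacobian f z

/-- The hyperbolic disk `D_h(a, ρ)` with center `a` and radius `ρ` in the unit disk. -/
def hyperbolicDisk (a : ℂ) (ρ : ℝ) : Set ℂ :=
  {z | z ∈ ball (0 : ℂ) 1 ∧ ‖(z - a) / (1 - conj a * z)‖ < Real.tanh ρ}

/-- Uniform local univalence: for some `ρ > 0`, the harmonic mapping `f` is injective on every
hyperbolic disk of radius `ρ`. -/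
def IsULU (f : ℂ → ℂ) : Prop :=
  IsHarmonicMapping f ∧
    ∃ ρ : ℝ, 0 < ρ ∧ ∀ a ∈ ball (0 : ℂ) 1, Set.InjOn f (hyperbolicDisk a ρ)

/-- The class `𝓑*_H(ν)` of harmonic `ν`-Bloch-type mappings: harmonic mappings `f` of the disk
with `sup_{z ∈ 𝔻} (1 - |z|²)^ν √|J_f(z)| < ∞`. -/
def blochType (ν : ℝ) : Set (ℂ → ℂ) :=
  {f | IsHarmonicMapping f ∧
    BddAbove ((fun z : ℂ => (1 - ‖z‖ ^ 2) ^ ν * √|jacobian f z|) '' ball (0 : ℂ) 1)}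

end HarmonicBloch

/-! Since `exp h = H' + ε G'`, the derivative `h'` is the pre-Schwarzian `(H'' + ε G'') / (H' + ε
G')`. A bounded dilatation gives `√|J_f| ≤ (1 + M) |h'|`, so everything rests on bounding `(1 -
|a|²) |h'(a)|`, which is `exists_bound_preSchwarzian`. The logarithm exists because `|ε G'| ≤ |G'| <
|H'|`.

By ULU, `F` is injective on a Euclidean disk about `a` of radius comparable to `1 - |a|`. After
rescaling, it remains to bound the pre-Schwarzian at `0` of `h + ε g` for an injective
sense-preserving `h + conj g` on the unit disk (`norm_preSchwarzian_le`). The affine change `f ↦ f -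
conj b * conj f` makes the dilatation vanish at `0`; Schwarz's lemma then controls `g''(0)` and
makes the dilatation at most `1/3` on `|z| < 1/3`.

The core is `norm_second_deriv_le`: `|h''(0)| ≤ C |h'(0)|` for injective maps with dilatation at
most `1/3`. Normalize `f(0) = 0` and the minimum of `|f|` on `|z| = 1/2` to be `1`. The maximum
principle for `z / h` gives `|h'(0)| ≥ 1`. A length-area argument in the spherical metric gives `|f|
≤ 2` on a fixed smaller disk, and Borel–Carathéodory with Cauchy's estimate then bounds `h''(0)`. -/

open Filter Topology Set MeasureTheory

/-! ### Differential and Jacobian of `h + conj g` -/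

namespace HarmonicBloch

/-- The real differential of `h + conj g` when `h' = a` and `g' = b`. -/
noncomputable def wirtingerCLM (a b : ℂ) : ℂ →L[ℝ] ℂ :=
  a • (1 : ℂ →L[ℝ] ℂ) + conj b • (conjCLE : ℂ →L[ℝ] ℂ)

@[simp] lemma wirtingerCLM_apply (a b v : ℂ) :
    wirtingerCLM a b v = a * v + conj (b * v) := by
  simp [wirtingerCLM]

lemma det_wirtingerCLM (a b : ℂ) : (wirtingerCLM a b).det = ‖a‖ ^ 2 - ‖b‖ ^ 2 := by
  rw [ContinuousLinearMap.det, ← LinearMap.det_toMatrix Complex.basisOneI, Matrix.det_fin_two]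
  simp [LinearMap.toMatrix_apply, Complex.sq_norm, Complex.normSq_apply]
  ring

lemma le_norm_wirtingerCLM (a b v : ℂ) : (‖a‖ - ‖b‖) * ‖v‖ ≤ ‖wirtingerCLM a b v‖ := by
  have := norm_sub_le_norm_add (a * v) (conj (b * v))
  rw [wirtingerCLM_apply]
  simp only [norm_mul, RCLike.norm_conj] at this
  linarith

lemma norm_wirtingerCLM_le (a b v : ℂ) : ‖wirtingerCLM a b v‖ ≤ (‖a‖ + ‖b‖) * ‖v‖ := by
  have := norm_add_le (a * v) (conj (b * v))
  rw [wirtingerCLM_apply]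
  simp only [norm_mul, RCLike.norm_conj] at this
  linarith

lemma hasStrictFDerivAt_add_conj {h g : ℂ → ℂ} {z : ℂ} (hh : AnalyticAt ℂ h z)
    (hg : AnalyticAt ℂ g z) :
    HasStrictFDerivAt (fun z => h z + conj (g z)) (wirtingerCLM (deriv h z) (deriv g z)) z := by
  have h1 := (hh.hasStrictDerivAt.hasStrictFDerivAt).restrictScalars ℝ
  have h2 := (hg.hasStrictDerivAt.hasStrictFDerivAt).restrictScalars ℝ
  have h3 := h1.add ((conjCLE : ℂ →L[ℝ] ℂ).hasStrictFDerivAt.comp z h2)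
  refine h3.congr_fderiv ?_
  ext; simp [wirtingerCLM_apply, mul_comm]

lemma dz_add_conj {h g : ℂ → ℂ} {z : ℂ} (hh : AnalyticAt ℂ h z) (hg : AnalyticAt ℂ g z) :
    dz (fun z => h z + conj (g z)) z = deriv h z := by
  rw [dz, (hasStrictFDerivAt_add_conj hh hg).hasFDerivAt.fderiv]
  simp only [wirtingerCLM_apply, map_mul, conj_I, map_one]
  linear_combination (-(deriv h z) / 2 + conj (deriv g z) / 2) * I_sq

lemma dzbar_add_conj {h g : ℂ → ℂ} {z : ℂ} (hh : AnalyticAt ℂ h z) (hg : AnalyticAt ℂ g z) :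
    dzbar (fun z => h z + conj (g z)) z = conj (deriv g z) := by
  rw [dzbar, (hasStrictFDerivAt_add_conj hh hg).hasFDerivAt.fderiv]
  simp only [wirtingerCLM_apply, map_mul, conj_I, map_one]
  linear_combination ((deriv h z) / 2 - conj (deriv g z) / 2) * I_sq

lemma jacobian_add_conj {h g : ℂ → ℂ} {z : ℂ} (hh : AnalyticAt ℂ h z) (hg : AnalyticAt ℂ g z) :
    jacobian (fun z => h z + conj (g z)) z = ‖deriv h z‖ ^ 2 - ‖deriv g z‖ ^ 2 := by
  rw [jacobian, dz_add_conj hh hg, dzbar_add_conj hh hg, RCLike.norm_conj]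

/-- An invertible form of `wirtingerCLM` for non-degenerate coefficients. -/
lemma exists_equiv_wirtingerCLM {a b : ℂ} (hab : ‖b‖ < ‖a‖) :
    ∃ e : ℂ ≃L[ℝ] ℂ, (e : ℂ →L[ℝ] ℂ) = wirtingerCLM a b := by
  have hker : LinearMap.ker (wirtingerCLM a b : ℂ →ₗ[ℝ] ℂ) = ⊥ := by
    rw [LinearMap.ker_eq_bot']
    intro v hv
    have h1 := le_norm_wirtingerCLM a b v
    have h2 : wirtingerCLM a b v = 0 := hv
    rw [h2, norm_zero] at h1
    by_contra hne
    have : 0 < (‖a‖ - ‖b‖) * ‖v‖ := mul_pos (by linarith) (norm_pos_iff.2 hne)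
    linarith
  refine ⟨(LinearEquiv.ofInjectiveEndo _ (LinearMap.ker_eq_bot.1 hker)).toContinuousLinearEquiv, ?_⟩
  ext; rfl

lemma map_nhds_add_conj {h g : ℂ → ℂ} {z : ℂ} (hh : AnalyticAt ℂ h z) (hg : AnalyticAt ℂ g z)
    (hlt : ‖deriv g z‖ < ‖deriv h z‖) :
    map (fun z => h z + conj (g z)) (𝓝 z) = 𝓝 (h z + conj (g z)) := by
  obtain ⟨e, he⟩ := exists_equiv_wirtingerCLM hlt
  have := hasStrictFDerivAt_add_conj hh hg
  rw [← he] at this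
  exact this.map_nhds_eq_of_equiv

lemma isHarmonicMapping_add_conj {h g : ℂ → ℂ} (hh : AnalyticOnNhd ℂ h (ball 0 1))
    (hg : AnalyticOnNhd ℂ g (ball 0 1)) : IsHarmonicMapping (fun z => h z + conj (g z)) := by
  intro z hz
  exact (hh z hz).harmonicAt.add (hg z hz).harmonicAt_conj

end HarmonicBloch
-- Topology of continuous open maps of the disk
namespace HarmonicBloch

section LocallyOpen

variable {f : ℂ → ℂ} {t : ℝ}

/-- A connectedness argument: the ball of radius `μ` avoids the image of the sphere, so it is
covered by two disjoint open sets, the image of the open ball and the complement of the image of the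
closed ball; it meets the first at `0`. The hypothesis `hf` encodes continuity and openness at once.
-/
lemma ball_subset_image_of_le_on_sphere (hf : ∀ z ∈ ball (0 : ℂ) 1, map f (𝓝 z) = 𝓝 (f z))
    (h0 : f 0 = 0) (ht0 : 0 < t) (ht : t < 1) {μ : ℝ} (hμ : ∀ z ∈ sphere (0 : ℂ) t, μ ≤ ‖f z‖) :
    ball 0 μ ⊆ f '' ball 0 t := by
  rcases le_or_gt μ 0 with hμ0 | hμ0
  · simp [ball_eq_empty.2 hμ0]
  have hcont : ContinuousOn f (closedBall 0 t) := fun z hz =>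
    ContinuousAt.continuousWithinAt (hf z (closedBall_subset_ball ht hz)).le
  have hopen : IsOpen (f '' ball 0 t) := by
    rw [isOpen_iff_mem_nhds]
    rintro _ ⟨z, hz, rfl⟩
    rw [← hf z (ball_subset_ball ht.le hz)]
    exact image_mem_map (isOpen_ball.mem_nhds hz)
  have hclosed : IsOpen (f '' closedBall 0 t)ᶜ :=
    ((isCompact_closedBall 0 t).image_of_continuousOn hcont).isClosed.isOpen_compl
  refine (convex_ball (0 : ℂ) μ).isPreconnected.subset_left_of_subset_union hopen hclosed ?_ ?_ ?_
  · exact disjoint_compl_right.mono_left (image_mono ball_subset_closedBall)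
  · intro w hw
    by_cases hwc : w ∈ f '' closedBall 0 t
    · obtain ⟨z, hz, rfl⟩ := hwc
      rcases (mem_closedBall_zero_iff.1 hz).lt_or_eq with h | h
      · exact Or.inl ⟨z, mem_ball_zero_iff.2 h, rfl⟩
      · have := hμ z (mem_sphere_zero_iff_norm.2 h)
        have := mem_ball_zero_iff.1 hw
        linarith
    · exact Or.inr hwc
  · exact ⟨0, mem_ball_self hμ0, 0, mem_ball_self ht0, h0⟩

/-- If `|f|` exceeded `|f z₁|` on the whole sphere, the value `f z₁` would also be taken strictly
inside it, against injectivity. -/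
lemma exists_mem_sphere_norm_le (hf : ∀ z ∈ ball (0 : ℂ) 1, map f (𝓝 z) = 𝓝 (f z))
    (hinj : InjOn f (ball 0 1)) (h0 : f 0 = 0) (ht0 : 0 < t) {z₁ : ℂ} (hz₁ : ‖z₁‖ < 1)
    (htz : t ≤ ‖z₁‖) : ∃ z, ‖z‖ = t ∧ ‖f z‖ ≤ ‖f z₁‖ := by
  have ht : t < 1 := htz.trans_lt hz₁
  have hcont : ContinuousOn (fun z => ‖f z‖) (sphere 0 t) := fun z hz =>
    (ContinuousAt.continuousWithinAt
      (hf z (closedBall_subset_ball ht (sphere_subset_closedBall hz))).le).norm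
  obtain ⟨z, hz, hmin⟩ := (isCompact_sphere (0 : ℂ) t).exists_isMinOn
    (NormedSpace.sphere_nonempty.2 ht0.le) hcont
  refine ⟨z, mem_sphere_zero_iff_norm.1 hz, ?_⟩
  by_contra! hlt
  obtain ⟨z', hz', he⟩ := ball_subset_image_of_le_on_sphere hf h0 ht0 ht
    (fun w hw => hmin hw) (mem_ball_zero_iff.2 hlt)
  have := hinj (ball_subset_ball ht.le hz') (mem_ball_zero_iff.2 hz₁) he
  subst this
  linarith [mem_ball_zero_iff.1 hz']

/-- Maximum modulus principle, which needs only openness: an interior maximum would put `f z` in the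
interior of the disk on whose boundary it lies. -/
lemma exists_mem_sphere_le_norm (hf : ∀ z ∈ ball (0 : ℂ) 1, map f (𝓝 z) = 𝓝 (f z))
    (ht : t < 1) {z₀ : ℂ} (hz₀ : ‖z₀‖ ≤ t) : ∃ z, ‖z‖ = t ∧ ‖f z₀‖ ≤ ‖f z‖ := by
  have hcont : ContinuousOn (fun z => ‖f z‖) (closedBall 0 t) := fun z hz =>
    (ContinuousAt.continuousWithinAt (hf z (closedBall_subset_ball ht hz)).le).norm
  obtain ⟨z, hz, hmax⟩ := (isCompact_closedBall (0 : ℂ) t).exists_isMaxOn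
    ⟨z₀, mem_closedBall_zero_iff.2 hz₀⟩ hcont
  refine ⟨z, ?_, hmax (mem_closedBall_zero_iff.2 hz₀)⟩
  by_contra hne
  have hzt : z ∈ ball (0 : ℂ) t :=
    mem_ball_zero_iff.2 (lt_of_le_of_ne (mem_closedBall_zero_iff.1 hz) hne)
  have himg : f '' ball 0 t ∈ 𝓝 (f z) := by
    rw [← hf z (ball_subset_ball ht.le hzt)]
    exact image_mem_map (isOpen_ball.mem_nhds hzt)
  have hsub : f '' ball 0 t ⊆ closedBall 0 ‖f z‖ := by
    rintro _ ⟨y, hy, rfl⟩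
    exact mem_closedBall_zero_iff.2 (hmax (ball_subset_closedBall hy))
  have hint : f z ∈ interior (closedBall (0 : ℂ) ‖f z‖) :=
    mem_interior_iff_mem_nhds.2 (mem_of_superset himg hsub)
  by_cases hfz : ‖f z‖ = 0
  · rw [hfz, closedBall_zero, interior_singleton] at hint
    exact hint
  · rw [interior_closedBall _ hfz] at hint
    simp at hint

end LocallyOpen

end HarmonicBloch
-- Length-area estimate in the spherical metric
namespace HarmonicBloch

/-- A closed curve meeting both `{|w| ≤ 1}` and `{|w| ≥ 2}` has spherical energy bounded below. -/
lemma le_integral_spherical_energy {v v' : ℝ → ℂ} (hv : ∀ y, HasDerivAt v (v' y) y)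
    (hc : Continuous v') {y₁ y₂ : ℝ} (hy₁ : y₁ ∈ Icc (-Real.pi) Real.pi)
    (hy₂ : y₂ ∈ Icc (-Real.pi) Real.pi) (h₁ : ‖v y₁‖ ≤ 1) (h₂ : 2 ≤ ‖v y₂‖) :
    9 / (200 * Real.pi) ≤ ∫ y in Ioo (-Real.pi) Real.pi, (‖v' y‖ / (1 + ‖v y‖ ^ 2)) ^ 2 := by
  have hpi := Real.pi_pos
  have hvc : Continuous v := continuous_iff_continuousAt.2 fun y => (hv y).continuousAt
  have hpos : ∀ y, 0 < 1 + ‖v y‖ ^ 2 := fun y => by positivity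
  set ℓ : ℝ → ℝ := fun y => ‖v' y‖ / (1 + ‖v y‖ ^ 2) with hℓ
  have hℓc : Continuous ℓ := hc.norm.div (by fun_prop) fun y => (hpos y).ne'
  -- Because `2|w| ≤ 1 + |w|²`, the function `1 / (1 + |w|²)` is 1-Lipschitz for the metric `|dw| /
  -- (1 + |w|²)`. It is at least `1/2` on `|w| ≤ 1` and at most `1/5` on `|w| ≥ 2`, whence the
  -- oscillation `3/10`.
  set u : ℝ → ℝ := fun y => (1 + ‖v y‖ ^ 2)⁻¹ with hu
  set u' : ℝ → ℝ := fun y => -(2 * inner ℝ (v y) (v' y)) / (1 + ‖v y‖ ^ 2) ^ 2 with hu'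
  have hud : ∀ y, HasDerivAt u (u' y) y := fun y =>
    ((hv y).norm_sq.const_add 1).inv (hpos y).ne'
  have hu'c : Continuous u' := by
    refine Continuous.div (by fun_prop) (by fun_prop) fun y => (pow_pos (hpos y) 2).ne'
  have hbound : ∀ y, ‖u' y‖ ≤ ℓ y := fun y => by
    rw [hu', hℓ]
    simp only [norm_div, norm_neg, norm_mul, norm_pow, Real.norm_of_nonneg (hpos y).le,
      Real.norm_ofNat]
    rw [div_le_div_iff₀ (pow_pos (hpos y) 2) (hpos y)]
    have h1 := norm_inner_le_norm (𝕜 := ℝ) (v y) (v' y)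
    have h2 : 2 * (‖v y‖ * ‖v' y‖) ≤ ‖v' y‖ * (1 + ‖v y‖ ^ 2) := by
      nlinarith [mul_nonneg (norm_nonneg (v' y)) (sq_nonneg (‖v y‖ - 1))]
    calc _ ≤ (‖v' y‖ * (1 + ‖v y‖ ^ 2)) * (1 + ‖v y‖ ^ 2) := by
          apply mul_le_mul_of_nonneg_right _ (hpos y).le
          linarith
      _ = _ := by ring
  have hosc : 3 / 10 ≤ ‖u y₁ - u y₂‖ := by
    have a1 : 1 / 2 ≤ u y₁ := by
      rw [hu]; simp only
      rw [one_div]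
      exact inv_anti₀ (hpos _) (by nlinarith [norm_nonneg (v y₁)])
    have a2 : u y₂ ≤ 1 / 5 := by
      rw [hu]; simp only
      rw [one_div]
      exact inv_anti₀ (by norm_num) (by nlinarith)
    rw [Real.norm_eq_abs]
    exact le_trans (by linarith) (le_abs_self _)
  have hint : ‖u y₁ - u y₂‖ ≤ ∫ y in (-Real.pi)..Real.pi, ℓ y := by
    rw [← intervalIntegral.integral_eq_sub_of_hasDerivAt (fun y _ => hud y)
      (hu'c.intervalIntegrable _ _)]
    refine (intervalIntegral.norm_integral_le_integral_norm_uIoc).trans ?_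
    rw [intervalIntegral.integral_of_le (by linarith)]
    refine (setIntegral_mono (hu'c.norm.integrableOn_uIoc) (hℓc.integrableOn_uIoc) hbound).trans ?_
    refine setIntegral_mono_set (hℓc.integrableOn_Ioc) (ae_of_all _ fun y => ?_) ?_
    · exact div_nonneg (norm_nonneg _) (hpos y).le
    · refine LE.le.eventuallyLE fun y hy => ?_
      rw [uIoc, mem_Ioc] at hy
      exact ⟨lt_of_le_of_lt (le_min hy₂.1 hy₁.1) hy.1, hy.2.trans (max_le hy₂.2 hy₁.2)⟩
  -- Cauchy–Schwarz as a completed square about `3 / (20π)`, which is the length `3/10` averaged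
  -- over an interval of length `2π`.
  have hsq : (∫ y in (-Real.pi)..Real.pi, ℓ y) ≤
      ∫ y in (-Real.pi)..Real.pi, (10 * Real.pi / 3 * ℓ y ^ 2 + 3 / (40 * Real.pi)) := by
    refine intervalIntegral.integral_mono (by linarith) (hℓc.intervalIntegrable _ _)
      ((by fun_prop : Continuous _).intervalIntegrable _ _) fun y => ?_
    have : 10 * Real.pi / 3 * ℓ y ^ 2 + 3 / (40 * Real.pi) - ℓ y =
        10 * Real.pi / 3 * (ℓ y - 3 / (20 * Real.pi)) ^ 2 := by
      field_simp
      ring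
    have h0 : 0 ≤ 10 * Real.pi / 3 * (ℓ y - 3 / (20 * Real.pi)) ^ 2 := by positivity
    simp only
    linarith
  rw [intervalIntegral.integral_add ((by fun_prop : Continuous _).intervalIntegrable _ _)
    ((by fun_prop : Continuous _).intervalIntegrable _ _), intervalIntegral.integral_const_mul,
    intervalIntegral.integral_const, smul_eq_mul] at hsq
  simp only [intervalIntegral.integral_of_le (by linarith : -Real.pi ≤ Real.pi),
    integral_Ioc_eq_integral_Ioo] at hint hsq
  have e1 : (Real.pi - -Real.pi) * (3 / (40 * Real.pi)) = 3 / 20 := by field_simp; ring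
  rw [e1] at hsq
  have h3 : 3 / 20 ≤ 10 * Real.pi / 3 * ∫ y in Ioo (-Real.pi) Real.pi, ℓ y ^ 2 := by linarith
  rw [div_le_iff₀ (by positivity)]
  nlinarith

/-- Total mass of the spherical area element `(1 + |w|²)⁻²`. -/
noncomputable def sphericalMass : ℝ := ∫ w : ℂ, ((1 : ℝ) + ‖w‖ ^ 2)⁻¹ ^ 2

lemma integrable_spherical : Integrable (fun w : ℂ => ((1 : ℝ) + ‖w‖ ^ 2)⁻¹ ^ 2) := by
  have := integrable_rpow_neg_one_add_norm_sq (E := ℂ) (μ := volume) (r := 4)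
    (by rw [Complex.finrank_real_complex]; norm_num)
  refine this.congr (ae_of_all _ fun w => ?_)
  have h : (0 : ℝ) ≤ 1 + ‖w‖ ^ 2 := by positivity
  simp only
  rw [show (-4 / 2 : ℝ) = -(2 : ℕ) by norm_num, Real.rpow_neg h, Real.rpow_natCast, inv_pow]

/-- Length-area estimate for a quasiconformal harmonic mapping of a rectangle. -/
lemma length_area {p q : ℂ → ℂ} {A B : ℝ} (hB : B ≤ 0)
    (hp : ∀ ζ : ℂ, ζ.re < 0 → AnalyticAt ℂ p ζ) (hq : ∀ ζ : ℂ, ζ.re < 0 → AnalyticAt ℂ q ζ)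
    (hpq : ∀ ζ : ℂ, ζ.re < 0 → ‖deriv q ζ‖ ≤ ‖deriv p ζ‖ / 3)
    (hinj : InjOn (fun ζ => p ζ + conj (q ζ)) (Ioo A B ×ℂ Ioo (-Real.pi) Real.pi))
    (hosc : ∀ x ∈ Ioo A B, ∃ y₁ ∈ Icc (-Real.pi) Real.pi, ∃ y₂ ∈ Icc (-Real.pi) Real.pi,
      ‖p (x + y₁ * I) + conj (q (x + y₁ * I))‖ ≤ 1 ∧
      2 ≤ ‖p (x + y₂ * I) + conj (q (x + y₂ * I))‖) :
    (B - A) * (9 / (200 * Real.pi)) ≤ 2 * sphericalMass := by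
  set f : ℂ → ℂ := fun ζ => p ζ + conj (q ζ) with hf
  set D : ℂ → ℂ →L[ℝ] ℂ := fun ζ => wirtingerCLM (deriv p ζ) (deriv q ζ) with hD
  set Q : Set ℂ := Ioo A B ×ℂ Ioo (-Real.pi) Real.pi with hQ
  have hQre : ∀ ζ ∈ Q, ζ.re < 0 := fun ζ hζ => hζ.1.2.trans_le hB
  have hfd : ∀ ζ : ℂ, ζ.re < 0 → HasFDerivAt f (D ζ) ζ := fun ζ hζ =>
    (hasStrictFDerivAt_add_conj (hp ζ hζ) (hq ζ hζ)).hasFDerivAt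
  have hQm : MeasurableSet Q := (isOpen_Ioo.reProdIm isOpen_Ioo).measurableSet
  set N : ℂ → ℝ := fun ζ => (‖D ζ I‖ / (1 + ‖f ζ‖ ^ 2)) ^ 2 with hN
  have hNc : ContinuousOn N {ζ | ζ.re < 0} := by
    have hpc : ContinuousOn (deriv p) {ζ | ζ.re < 0} := fun ζ hζ =>
      (hp ζ hζ).deriv.continuousAt.continuousWithinAt
    have hqc : ContinuousOn (deriv q) {ζ | ζ.re < 0} := fun ζ hζ =>
      (hq ζ hζ).deriv.continuousAt.continuousWithinAt
    have hfc : ContinuousOn f {ζ | ζ.re < 0} := fun ζ hζ =>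
      (hfd ζ hζ).continuousAt.continuousWithinAt
    have hDc : ContinuousOn (fun ζ => D ζ I) {ζ | ζ.re < 0} := by
      simp only [hD, wirtingerCLM_apply]
      fun_prop
    refine (hDc.norm.div (by fun_prop) fun ζ _ => ?_).pow 2
    positivity
  have hupper : ∫⁻ ζ in Q, ENNReal.ofReal (N ζ) ≤ ENNReal.ofReal (2 * sphericalMass) := by
    calc ∫⁻ ζ in Q, ENNReal.ofReal (N ζ)
        ≤ ∫⁻ ζ in Q, ENNReal.ofReal |(D ζ).det| *
            ENNReal.ofReal (2 * (1 + ‖f ζ‖ ^ 2)⁻¹ ^ 2) := by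
          refine setLIntegral_mono' hQm fun ζ hζ => ?_
          rw [← ENNReal.ofReal_mul (abs_nonneg _)]
          refine ENNReal.ofReal_le_ofReal ?_
          have h1 := norm_wirtingerCLM_le (deriv p ζ) (deriv q ζ) I
          rw [norm_I, mul_one] at h1
          have h2 := hpq ζ (hQre ζ hζ)
          -- The factor `2` is exact for dilatation `1/3`: `(1 + 1/3)² = 2 (1 - 1/9)`.
          have h3 : ‖D ζ I‖ ^ 2 ≤ 2 * |(D ζ).det| := by
            refine (pow_le_pow_left₀ (norm_nonneg _) h1 2).trans ?_
            have h4 := le_abs_self ((D ζ).det)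
            have h5 : (D ζ).det = ‖deriv p ζ‖ ^ 2 - ‖deriv q ζ‖ ^ 2 := det_wirtingerCLM _ _
            nlinarith [norm_nonneg (deriv p ζ), norm_nonneg (deriv q ζ)]
          rw [hN]; simp only
          rw [div_pow, div_eq_mul_inv, ← inv_pow]
          calc _ ≤ 2 * |(D ζ).det| * (1 + ‖f ζ‖ ^ 2)⁻¹ ^ 2 := by gcongr
            _ = _ := by ring
      _ = ∫⁻ w in f '' Q, ENNReal.ofReal (2 * (1 + ‖w‖ ^ 2)⁻¹ ^ 2) :=
          (lintegral_image_eq_lintegral_abs_det_fderiv_mul volume hQm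
            (fun ζ hζ => (hfd ζ (hQre ζ hζ)).hasFDerivWithinAt) hinj
            (fun w => ENNReal.ofReal (2 * (1 + ‖w‖ ^ 2)⁻¹ ^ 2))).symm
      _ ≤ ∫⁻ w : ℂ, ENNReal.ofReal (2 * (1 + ‖w‖ ^ 2)⁻¹ ^ 2) := setLIntegral_le_lintegral _ _
      _ = ENNReal.ofReal (2 * sphericalMass) := by
          rw [sphericalMass, ← integral_const_mul,
            ofReal_integral_eq_lintegral_ofReal (integrable_spherical.const_mul 2)]
          exact ae_of_all _ fun w => by positivity
  have hlower : ENNReal.ofReal ((B - A) * (9 / (200 * Real.pi))) ≤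
      ∫⁻ ζ in Q, ENNReal.ofReal (N ζ) := by
    have e1 : ∫⁻ ζ in Q, ENNReal.ofReal (N ζ) =
        ∫⁻ z in Ioo A B ×ˢ Ioo (-Real.pi) Real.pi,
          ENNReal.ofReal (N (measurableEquivRealProd.symm z)) := by
      rw [← volume_preserving_equiv_real_prod.symm.setLIntegral_comp_preimage_emb
        measurableEquivRealProd.symm.measurableEmbedding]
      rfl
    rw [e1, Measure.volume_eq_prod, setLIntegral_prod]
    · calc ENNReal.ofReal ((B - A) * (9 / (200 * Real.pi)))
          = ∫⁻ x in Ioo A B, ENNReal.ofReal (9 / (200 * Real.pi)) := by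
            rw [setLIntegral_const, Real.volume_Ioo, mul_comm (B - A),
              ENNReal.ofReal_mul (by positivity)]
        _ ≤ _ := by
            refine setLIntegral_mono' measurableSet_Ioo fun x hx => ?_
            have hx0 : ∀ y : ℝ, ((x : ℂ) + y * I).re < 0 := fun y => by
              simpa using hx.2.trans_le hB
            obtain ⟨y₁, hy₁, y₂, hy₂, h₁, h₂⟩ := hosc x hx
            have hline : ∀ y : ℝ, HasDerivAt (fun y : ℝ => (x : ℂ) + y * I) I y := fun y => by
              simpa using ((hasDerivAt_id y).ofReal_comp.mul_const I).const_add (x : ℂ)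
            have hv : ∀ y : ℝ, HasDerivAt (fun y : ℝ => f (x + y * I)) (D (x + y * I) I) y :=
              fun y => (hfd _ (hx0 y)).comp_hasDerivAt y (hline y)
            have hlc : Continuous fun y : ℝ => (x : ℂ) + y * I := by fun_prop
            have hc : Continuous fun y : ℝ => D (x + y * I) I := by
              have hpc : Continuous fun y : ℝ => deriv p (x + y * I) :=
                continuous_iff_continuousAt.2 fun y =>
                  (hp _ (hx0 y)).deriv.continuousAt.comp (f := fun y : ℝ => (x : ℂ) + y * I)
                    hlc.continuousAt
              have hqc : Continuous fun y : ℝ => deriv q (x + y * I) :=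
                continuous_iff_continuousAt.2 fun y =>
                  (hq _ (hx0 y)).deriv.continuousAt.comp (f := fun y : ℝ => (x : ℂ) + y * I)
                    hlc.continuousAt
              simp only [hD, wirtingerCLM_apply]
              fun_prop
            refine (ENNReal.ofReal_le_ofReal
              (le_integral_spherical_energy hv hc hy₁ hy₂ h₁ h₂)).trans_eq ?_
            rw [ofReal_integral_eq_lintegral_ofReal]
            · refine lintegral_congr fun y => ?_
              simp only [hN, measurableEquivRealProd_symm_apply, Complex.mk_eq_add_mul_I]
            · have : Continuous fun y : ℝ => N (x + y * I) := by
                refine continuous_iff_continuousAt.2 fun y => ?_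
                exact (hNc.continuousAt ((isOpen_lt continuous_re continuous_const).mem_nhds
                  (hx0 y))).comp (f := fun y : ℝ => (x : ℂ) + y * I) hlc.continuousAt
              exact (this.integrableOn_Icc).mono_set Ioo_subset_Icc_self
            · exact ae_of_all _ fun y => by positivity
    · refine (ContinuousOn.aemeasurable ?_ (measurableSet_Ioo.prod measurableSet_Ioo))
      refine ENNReal.continuous_ofReal.comp_continuousOn (hNc.comp ?_ ?_)
      · exact equivRealProdCLM.symm.continuous.continuousOn
      · rintro ⟨x, y⟩ hxy
        exact hxy.1.2.trans_le hB
  have hm : 0 ≤ 2 * sphericalMass :=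
    mul_nonneg zero_le_two (integral_nonneg fun w => by positivity)
  exact (ENNReal.ofReal_le_ofReal_iff hm).1 (hlower.trans hupper)

end HarmonicBloch
-- Distortion of injective harmonic maps with dilatation at most `1/3`
namespace HarmonicBloch

section Distortion

variable {h g : ℂ → ℂ}

lemma map_nhds_of_dilatation (hh : AnalyticOnNhd ℂ h (ball 0 1))
    (hg : AnalyticOnNhd ℂ g (ball 0 1)) (hne : ∀ z ∈ ball (0 : ℂ) 1, deriv h z ≠ 0)
    (hdil : ∀ z ∈ ball (0 : ℂ) 1, ‖deriv g z‖ ≤ ‖deriv h z‖ / 3) :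
    ∀ z ∈ ball (0 : ℂ) 1, map (fun z => h z + conj (g z)) (𝓝 z) = 𝓝 (h z + conj (g z)) :=
  fun z hz => map_nhds_add_conj (hh z hz) (hg z hz) <| by
    have := norm_pos_iff.2 (hne z hz)
    linarith [hdil z hz]

/-- If the image of `f = h + conj g` contains the unit disk, then `g` is controlled by `f`
on the preimage of that disk. -/
lemma norm_coanalytic_le_half (hh : AnalyticOnNhd ℂ h (ball 0 1))
    (hg : AnalyticOnNhd ℂ g (ball 0 1)) (hne : ∀ z ∈ ball (0 : ℂ) 1, deriv h z ≠ 0)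
    (hdil : ∀ z ∈ ball (0 : ℂ) 1, ‖deriv g z‖ ≤ ‖deriv h z‖ / 3)
    (hinj : InjOn (fun z => h z + conj (g z)) (ball 0 1)) (h0 : h 0 = 0) (g0 : g 0 = 0)
    (hsub : ball 0 1 ⊆ (fun z => h z + conj (g z)) '' ball 0 1)
    {z : ℂ} (hz : z ∈ ball (0 : ℂ) 1) (hfz : ‖h z + conj (g z)‖ < 1) :
    ‖g z‖ ≤ ‖h z + conj (g z)‖ / 2 := by
  set f : ℂ → ℂ := fun z => h z + conj (g z) with hf
  have hmap : ∀ z ∈ ball (0 : ℂ) 1, map f (𝓝 z) = 𝓝 (f z) :=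
    map_nhds_of_dilatation hh hg hne hdil
  set k : ℂ → ℂ := Function.invFunOn f (ball 0 1) with hk
  have hkf : ∀ z ∈ ball (0 : ℂ) 1, k (f z) = z := fun z hz => hinj.leftInvOn_invFunOn hz
  -- The map `g ∘ f⁻¹` has differential of norm at most `|g'| / (|h'| - |g'|) ≤ (1/3) / (2/3)`. Its
  -- domain, the unit disk, is convex, so it is Lipschitz with constant `1/2`.
  have hderiv : ∀ w ∈ ball (0 : ℂ) 1, ∃ L : ℂ →L[ℝ] ℂ,
      HasFDerivAt (fun w => g (k w)) L w ∧ ‖L‖ ≤ 1 / 2 := by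
    intro w hw
    obtain ⟨z, hz, rfl⟩ := hsub hw
    have hpos := norm_pos_iff.2 (hne z hz)
    have hd := hdil z hz
    obtain ⟨e, he⟩ := exists_equiv_wirtingerCLM (show ‖deriv g z‖ < ‖deriv h z‖ by linarith)
    have hkt : Tendsto k (𝓝 (f z)) (𝓝 z) := by
      rw [← hmap z hz, tendsto_map'_iff]
      refine tendsto_id.congr' ?_
      filter_upwards [isOpen_ball.mem_nhds hz] with y hy using (hkf y hy).symm
    have hkd : HasFDerivAt k (e.symm : ℂ →L[ℝ] ℂ) (f z) := by
      refine HasFDerivAt.of_local_left_inverse (f := f) ?_ ?_ ?_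
      · rw [ContinuousAt, hkf z hz]; exact hkt
      · rw [he, hkf z hz]
        exact (hasStrictFDerivAt_add_conj (hh z hz) (hg z hz)).hasFDerivAt
      · rw [← hmap z hz, eventually_map]
        filter_upwards [isOpen_ball.mem_nhds hz] with y hy
        rw [hkf y hy]
    have hgd : HasFDerivAt g ((ContinuousLinearMap.toSpanSingleton ℂ (deriv g z)).restrictScalars ℝ)
        (k (f z)) := by
      rw [hkf z hz]
      exact ((hg z hz).differentiableAt.hasDerivAt.hasFDerivAt).restrictScalars ℝ
    refine ⟨_, hgd.comp (f z) hkd, ContinuousLinearMap.opNorm_le_bound _ (by norm_num) fun v => ?_⟩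
    have h1 := le_norm_wirtingerCLM (deriv h z) (deriv g z) (e.symm v)
    rw [← he, ContinuousLinearEquiv.coe_coe, e.apply_symm_apply] at h1
    simp only [ContinuousLinearMap.comp_apply, ContinuousLinearMap.coe_restrictScalars',
      ContinuousLinearMap.toSpanSingleton_apply, ContinuousLinearEquiv.coe_coe, smul_eq_mul,
      norm_mul]
    nlinarith [norm_nonneg (e.symm v)]
  choose! L hL hLn using hderiv
  have hf0 : f 0 = 0 := by simp [hf, h0, g0]
  have hk0 : k 0 = 0 := by
    have := hkf 0 (mem_ball_self one_pos)
    rwa [hf0] at this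
  have hmv := (convex_ball (0 : ℂ) 1).norm_image_sub_le_of_norm_hasFDerivWithin_le
    (fun w hw => (hL w hw).hasFDerivWithinAt) hLn (mem_ball_self one_pos)
    (mem_ball_zero_iff.2 hfz)
  rw [hkf z hz, hk0, g0, sub_zero, sub_zero] at hmv
  linarith

/-- A Koebe-type lower bound: if `f` omits no value of the unit disk on `|z| < 1/2`, then its
analytic part is not flat at the origin. -/
lemma one_le_norm_deriv (hh : AnalyticOnNhd ℂ h (ball 0 1))
    (hg : AnalyticOnNhd ℂ g (ball 0 1)) (hne : ∀ z ∈ ball (0 : ℂ) 1, deriv h z ≠ 0)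
    (hdil : ∀ z ∈ ball (0 : ℂ) 1, ‖deriv g z‖ ≤ ‖deriv h z‖ / 3)
    (hinj : InjOn (fun z => h z + conj (g z)) (ball 0 1)) (h0 : h 0 = 0) (g0 : g 0 = 0)
    (hμ : ∀ z ∈ sphere (0 : ℂ) (1 / 2), 1 ≤ ‖h z + conj (g z)‖) : 1 ≤ ‖deriv h 0‖ := by
  set f : ℂ → ℂ := fun z => h z + conj (g z) with hf
  have hmap : ∀ z ∈ ball (0 : ℂ) 1, map f (𝓝 z) = 𝓝 (f z) :=
    map_nhds_of_dilatation hh hg hne hdil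
  have hfc : ContinuousOn f (ball 0 1) := fun z hz =>
    ContinuousAt.continuousWithinAt (hmap z hz).le
  have hf0 : f 0 = 0 := by simp [hf, h0, g0]
  have hsub : ball 0 1 ⊆ f '' ball 0 1 :=
    (ball_subset_image_of_le_on_sphere hmap hf0 (by norm_num) (by norm_num) hμ).trans
      (image_mono (ball_subset_ball (by norm_num)))
  have hhalf : closedBall (0 : ℂ) (1 / 2) ⊆ ball 0 1 := closedBall_subset_ball (by norm_num)
  -- The maximum principle is applied on `U` to `z / h`, the inverse of `dslope h 0`. Its
  -- pole-freeness comes from injectivity: `|h| ≥ |f| / 2` forces zeros of `h` to be zeros of `f`.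
  set U : Set ℂ := ball 0 (1 / 2) ∩ f ⁻¹' ball 0 1 with hU
  have hUo : IsOpen U :=
    (hfc.mono (ball_subset_closedBall.trans hhalf)).isOpen_inter_preimage isOpen_ball isOpen_ball
  have hUcl : closure U ⊆ closedBall 0 (1 / 2) :=
    closure_minimal (inter_subset_left.trans ball_subset_closedBall) isClosed_closedBall
  have hUcl' : closure U ⊆ ball 0 1 := hUcl.trans hhalf
  have hfU : ContinuousOn (fun z => ‖f z‖) (closure U) := (hfc.mono hUcl').norm
  have hhU : ContinuousOn (fun z => ‖h z‖) (closure U) := (hh.continuousOn.mono hUcl').norm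
  have hlow : ∀ z ∈ closure U, ‖f z‖ / 2 ≤ ‖h z‖ := by
    intro z hz
    refine le_on_closure (fun z hz => ?_) (hfU.div_const 2) hhU hz
    have h1 := norm_coanalytic_le_half hh hg hne hdil hinj h0 g0 hsub
      (hhalf (ball_subset_closedBall hz.1)) (mem_ball_zero_iff.1 hz.2)
    have h2 := norm_add_le (h z) (conj (g z))
    rw [RCLike.norm_conj] at h2
    change ‖h z + conj (g z)‖ / 2 ≤ ‖h z‖
    linarith
  have hup : ∀ z ∈ closure U, ‖f z‖ ≤ 1 := fun z hz =>
    le_on_closure (fun z hz => (mem_ball_zero_iff.1 hz.2).le) hfU continuousOn_const hz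
  have hh0 : ∀ z ∈ closure U, z ≠ 0 → h z ≠ 0 := by
    intro z hz hz0 hhz
    have h1 := hlow z hz
    rw [hhz, norm_zero] at h1
    have h2 : f z = f 0 := by
      rw [hf0]
      exact norm_le_zero_iff.1 (by linarith)
    exact hz0 (hinj (hUcl' hz) (mem_ball_self one_pos) h2)
  have hds : ∀ z, z ≠ 0 → dslope h 0 z = h z / z := fun z hz => by
    rw [dslope_of_ne _ hz, slope_def_field, h0, sub_zero, sub_zero]
  have hdne : ∀ z ∈ closure U, dslope h 0 z ≠ 0 := by
    intro z hz
    by_cases hz0 : z = 0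
    · rw [hz0, dslope_same]
      exact hne 0 (mem_ball_self one_pos)
    · rw [hds z hz0]
      exact div_ne_zero (hh0 z hz hz0) hz0
  have hdiff : DifferentiableOn ℂ (fun z => (dslope h 0 z)⁻¹) (closure U) :=
    (((Complex.differentiableOn_dslope (isOpen_ball.mem_nhds (mem_ball_self one_pos))).2
      hh.differentiableOn).mono hUcl').inv hdne
  -- On the frontier `|f| ≥ 1`, hence `|h| ≥ 1/2 ≥ |z|`.
  have hfront : ∀ z ∈ frontier U, ‖(dslope h 0 z)⁻¹‖ ≤ 1 := by
    intro z hz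
    rw [hUo.frontier_eq] at hz
    have hzn : ‖z‖ ≤ 1 / 2 := mem_closedBall_zero_iff.1 (hUcl hz.1)
    have hfz : 1 ≤ ‖f z‖ := by
      by_contra! hlt
      rcases hzn.lt_or_eq with h1 | h1
      · exact hz.2 ⟨mem_ball_zero_iff.2 h1, mem_ball_zero_iff.2 hlt⟩
      · exact absurd (hμ z (mem_sphere_zero_iff_norm.2 h1)) (not_le.2 hlt)
    have hz0 : z ≠ 0 := by
      rintro rfl
      rw [hf0, norm_zero] at hfz
      linarith
    have hl := hlow z hz.1
    rw [hds z hz0, inv_div, norm_div]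
    exact div_le_one_of_le₀ (by linarith) (norm_nonneg _)
  have h0U : (0 : ℂ) ∈ U := ⟨mem_ball_self (by norm_num), by simp [hf0]⟩
  have hfin := norm_le_of_forall_mem_frontier_norm_le (isBounded_ball.subset inter_subset_left)
    hdiff.diffContOnCl hfront (subset_closure h0U)
  simp only [dslope_same, norm_inv] at hfin
  exact (inv_le_one₀ (norm_pos_iff.2 (hne 0 (mem_ball_self one_pos)))).1 hfin

/-- Logarithmic width of an annulus that is too thick to carry a curve family of large
oscillation under a `2`-quasiconformal harmonic mapping. -/
noncomputable def criticalWidth : ℝ := (2 * sphericalMass + 1) * (200 * Real.pi / 9)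

lemma criticalWidth_pos : 0 < criticalWidth := by
  have : 0 ≤ sphericalMass := integral_nonneg fun w => by positivity
  have := Real.pi_pos
  unfold criticalWidth
  positivity

/-- Suppose `|f z| > 2`. Then every circle about `0` with radius between `exp (-criticalWidth) / 2`
and `1/2` has an image meeting both `|w| ≤ 1` and `|w| ≥ 2`. In the coordinate `log z` these circles
sweep a rectangle of width `criticalWidth`, for which `length_area` would give `2 * sphericalMass +
1 ≤ 2 * sphericalMass`. -/
lemma norm_le_two_of_small (hh : AnalyticOnNhd ℂ h (ball 0 1))
    (hg : AnalyticOnNhd ℂ g (ball 0 1)) (hne : ∀ z ∈ ball (0 : ℂ) 1, deriv h z ≠ 0)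
    (hdil : ∀ z ∈ ball (0 : ℂ) 1, ‖deriv g z‖ ≤ ‖deriv h z‖ / 3)
    (hinj : InjOn (fun z => h z + conj (g z)) (ball 0 1)) (h0 : h 0 = 0) (g0 : g 0 = 0)
    {z₁ : ℂ} (hz₁ : ‖z₁‖ = 1 / 2) (hfz₁ : ‖h z₁ + conj (g z₁)‖ ≤ 1)
    {z : ℂ} (hz : ‖z‖ ≤ Real.exp (-criticalWidth) / 2) : ‖h z + conj (g z)‖ ≤ 2 := by
  by_contra! hlt
  set f : ℂ → ℂ := fun z => h z + conj (g z) with hf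
  have hmap : ∀ z ∈ ball (0 : ℂ) 1, map f (𝓝 z) = 𝓝 (f z) :=
    map_nhds_of_dilatation hh hg hne hdil
  have hf0 : f 0 = 0 := by simp [hf, h0, g0]
  have hexp : ∀ ζ : ℂ, ζ.re < 0 → exp ζ ∈ ball (0 : ℂ) 1 := fun ζ hζ => by
    rw [mem_ball_zero_iff, Complex.norm_exp]
    exact Real.exp_lt_one_iff.2 hζ
  have hderiv : ∀ F : ℂ → ℂ, AnalyticOnNhd ℂ F (ball 0 1) → ∀ ζ : ℂ, ζ.re < 0 →
      deriv (fun ζ => F (exp ζ)) ζ = deriv F (exp ζ) * exp ζ := fun F hF ζ hζ =>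
    ((hF _ (hexp ζ hζ)).differentiableAt.hasDerivAt.comp ζ (Complex.hasDerivAt_exp ζ)).deriv
  have han : ∀ F : ℂ → ℂ, AnalyticOnNhd ℂ F (ball 0 1) → ∀ ζ : ℂ, ζ.re < 0 →
      AnalyticAt ℂ (fun ζ => F (exp ζ)) ζ := fun F hF ζ hζ =>
    (hF _ (hexp ζ hζ)).comp (f := exp) (analyticAt_cexp)
  have hlog2 : 0 < Real.log 2 := Real.log_pos one_lt_two
  have hB : Real.exp (-Real.log 2) = 1 / 2 := by
    rw [Real.exp_neg, Real.exp_log two_pos, one_div]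
  have hA : Real.exp (-Real.log 2 - criticalWidth) = Real.exp (-criticalWidth) / 2 := by
    rw [sub_eq_add_neg, Real.exp_add, hB]; ring
  -- The argument may equal `π`, which is why `length_area` takes its oscillation points in a closed
  -- interval while injectivity is required only on the open rectangle.
  have hpolar : ∀ (x : ℝ) (w : ℂ), ‖w‖ = Real.exp x → exp (x + w.arg * I) = w := fun x w hw => by
    rw [Complex.exp_add, ← Complex.ofReal_exp, ← hw, Complex.norm_mul_exp_arg_mul_I]
  have key := length_area (p := fun ζ => h (exp ζ)) (q := fun ζ => g (exp ζ))
    (A := -Real.log 2 - criticalWidth) (B := -Real.log 2) (by linarith)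
    (han h hh) (han g hg) ?_ ?_ ?_
  · have : criticalWidth * (9 / (200 * Real.pi)) = 2 * sphericalMass + 1 := by
      unfold criticalWidth
      have := Real.pi_pos.ne'
      field_simp
    have e : -Real.log 2 - (-Real.log 2 - criticalWidth) = criticalWidth := by ring
    rw [e] at key
    linarith
  · intro ζ hζ
    rw [hderiv h hh ζ hζ, hderiv g hg ζ hζ, norm_mul, norm_mul]
    calc _ ≤ ‖deriv h (exp ζ)‖ / 3 * ‖exp ζ‖ := by
          gcongr
          exact hdil _ (hexp ζ hζ)
      _ = _ := by ring
  · intro ζ₁ hζ₁ ζ₂ hζ₂ he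
    have hneg : ∀ ζ : ℂ, ζ ∈ Ioo (-Real.log 2 - criticalWidth) (-Real.log 2) ×ℂ
        Ioo (-Real.pi) Real.pi → ζ.re < 0 := fun ζ hζ => by
      have := hζ.1.2
      linarith
    have h1 : exp ζ₁ = exp ζ₂ := hinj (hexp _ (hneg _ hζ₁)) (hexp _ (hneg _ hζ₂)) he
    exact Complex.exp_inj_of_neg_pi_lt_of_le_pi hζ₁.2.1 hζ₁.2.2.le hζ₂.2.1 hζ₂.2.2.le h1
  · intro x hx
    have ht : Real.exp x ≤ ‖z₁‖ := by
      rw [hz₁, ← hB]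
      exact Real.exp_le_exp.2 hx.2.le
    have hs : ‖z‖ ≤ Real.exp x := hz.trans (by rw [← hA]; exact Real.exp_le_exp.2 hx.1.le)
    obtain ⟨w₁, hw₁, hfw₁⟩ := exists_mem_sphere_norm_le hmap hinj hf0 (Real.exp_pos x)
      (by rw [hz₁]; norm_num) ht
    obtain ⟨w₂, hw₂, hfw₂⟩ := exists_mem_sphere_le_norm hmap
      (by rw [hz₁] at ht; linarith : Real.exp x < 1) hs
    refine ⟨w₁.arg, ⟨(neg_pi_lt_arg _).le, arg_le_pi _⟩, w₂.arg,
      ⟨(neg_pi_lt_arg _).le, arg_le_pi _⟩, ?_, ?_⟩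
    · rw [hpolar x w₁ hw₁]
      exact hfw₁.trans hfz₁
    · rw [hpolar x w₂ hw₂]
      exact hlt.le.trans hfw₂

/-- Cauchy-type estimate for the analytic part of a bounded harmonic function. -/
lemma norm_second_deriv_le_of_bounded {s : ℝ} (hs : 0 < s) (hh : AnalyticOnNhd ℂ h (ball 0 s))
    (hg : AnalyticOnNhd ℂ g (ball 0 s)) (h0 : h 0 = 0) (g0 : g 0 = 0)
    (hb : ∀ z ∈ ball (0 : ℂ) s, ‖h z + conj (g z)‖ ≤ 2) :
    ‖deriv (deriv h) 0‖ ≤ 32 / s ^ 2 := by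
  have hmul : ∀ z ∈ ball (0 : ℂ) (s / 2), ∀ F : ℂ → ℂ, DifferentiableOn ℂ F (ball 0 s) →
      F 0 = 0 → MapsTo F (ball 0 s) {z | z.re ≤ 2} → ‖F z‖ ≤ 4 := by
    intro z hz F hF hF0 hre
    have hzs := mem_ball_zero_iff.1 hz
    refine (borelCaratheodory_zero two_pos hF hre hs
      (ball_subset_ball (by linarith) hz) hF0).trans ?_
    rw [div_le_iff₀ (by linarith)]
    linarith
  have hbound : ∀ z ∈ ball (0 : ℂ) (s / 2), ‖h z‖ ≤ 4 := by
    intro z hz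
    -- `h + g` has the same real part as `h + conj g`, and `-I * (h - g)` has real part equal to the
    -- imaginary part of `h + conj g`, so both fall under Borel–Carathéodory.
    have h1 := hmul z hz (fun z => h z + g z) (hh.differentiableOn.add hg.differentiableOn)
      (by simp [h0, g0]) fun w hw => by
        have := (re_le_norm _).trans (hb w hw)
        simpa using this
    have h2 := hmul z hz (fun z => -I * (h z - g z))
      ((hh.differentiableOn.sub hg.differentiableOn).const_mul _) (by simp [h0, g0])
      fun w hw => by
        have := ((le_abs_self _).trans (abs_im_le_norm _)).trans (hb w hw)
        simpa [sub_eq_add_neg] using this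
    rw [norm_mul, norm_neg, norm_I, one_mul] at h2
    have h3 : (2 : ℂ) * h z = (h z + g z) + (h z - g z) := by ring
    have h4 := norm_add_le (h z + g z) (h z - g z)
    rw [← h3, norm_mul, Complex.norm_ofNat] at h4
    linarith
  have hsub : closedBall (0 : ℂ) (s / 2) ⊆ ball 0 s := closedBall_subset_ball (by linarith)
  have hclos : ∀ z ∈ sphere (0 : ℂ) (s / 2), ‖h z‖ ≤ 4 := fun z hz => by
    have hc : closure (ball (0 : ℂ) (s / 2)) = closedBall 0 (s / 2) := closure_ball _ (by positivity)
    refine le_on_closure hbound ?_ continuousOn_const (hc ▸ sphere_subset_closedBall hz)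
    rw [hc]
    exact (hh.continuousOn.mono hsub).norm
  have hd : DiffContOnCl ℂ h (ball 0 (s / 2)) :=
    (hh.differentiableOn.mono (by rwa [closure_ball _ (by positivity)])).diffContOnCl
  have := norm_iteratedDeriv_le_of_forall_mem_sphere_norm_le 2 (by positivity : 0 < s / 2) hd hclos
  rw [iteratedDeriv_succ, iteratedDeriv_one] at this
  refine this.trans_eq ?_
  norm_num [Nat.factorial]
  field_simp
  norm_num

/-- A bound for the second coefficient of injective harmonic mappings with small dilatation. -/
noncomputable def coeffBound : ℝ := 32 / (Real.exp (-criticalWidth) / 2) ^ 2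

lemma coeffBound_pos : 0 < coeffBound := by unfold coeffBound; positivity

/-- The inequality is unchanged by translating and scaling `f`. Dividing by `m`, the minimum of `|f
- f 0|` on `|z| = 1/2`, gives the normalization under which both the lower bound for `h'(0)` and the
upper bound for `h''(0)` are absolute. -/
theorem norm_second_deriv_le (hh : AnalyticOnNhd ℂ h (ball 0 1))
    (hg : AnalyticOnNhd ℂ g (ball 0 1)) (hne : ∀ z ∈ ball (0 : ℂ) 1, deriv h z ≠ 0)
    (hdil : ∀ z ∈ ball (0 : ℂ) 1, ‖deriv g z‖ ≤ ‖deriv h z‖ / 3)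
    (hinj : InjOn (fun z => h z + conj (g z)) (ball 0 1)) :
    ‖deriv (deriv h) 0‖ ≤ coeffBound * ‖deriv h 0‖ := by
  set f : ℂ → ℂ := fun z => h z + conj (g z) with hf
  have hfc : ContinuousOn f (ball 0 1) := fun z hz => ContinuousAt.continuousWithinAt
    (map_nhds_of_dilatation hh hg hne hdil z hz).le
  have hhalf : sphere (0 : ℂ) (1 / 2) ⊆ ball 0 1 :=
    sphere_subset_closedBall.trans (closedBall_subset_ball (by norm_num))
  obtain ⟨z₁, hz₁, hmin⟩ := (isCompact_sphere (0 : ℂ) (1 / 2)).exists_isMinOn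
    (f := fun z => ‖f z - f 0‖) (NormedSpace.sphere_nonempty.2 (by norm_num))
    ((hfc.mono hhalf).sub continuousOn_const).norm
  set m : ℝ := ‖f z₁ - f 0‖ with hm
  have hmpos : 0 < m := by
    refine norm_pos_iff.2 (sub_ne_zero.2 fun he => ?_)
    have := hinj (hhalf hz₁) (mem_ball_self one_pos) he
    rw [this] at hz₁
    norm_num at hz₁
  have hmC : (m : ℂ) ≠ 0 := by exact_mod_cast hmpos.ne'
  set h₁ : ℂ → ℂ := fun z => (h z - h 0) / m with hh₁
  set g₁ : ℂ → ℂ := fun z => (g z - g 0) / m with hg₁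
  have hf₁ : ∀ z, h₁ z + conj (g₁ z) = (f z - f 0) / m := fun z => by
    simp only [hh₁, hg₁, hf, map_div₀, map_sub, conj_ofReal]
    ring
  have hdh : ∀ z, deriv h₁ z = deriv h z / m := fun z => by simp [hh₁]
  have hdg : ∀ z, deriv g₁ z = deriv g z / m := fun z => by simp [hg₁]
  have hah : AnalyticOnNhd ℂ h₁ (ball 0 1) := fun z hz =>
    ((hh z hz).sub analyticAt_const).div analyticAt_const hmC
  have hag : AnalyticOnNhd ℂ g₁ (ball 0 1) := fun z hz =>
    ((hg z hz).sub analyticAt_const).div analyticAt_const hmC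
  have hn : ∀ z ∈ ball (0 : ℂ) 1, deriv h₁ z ≠ 0 := fun z hz => by
    rw [hdh]; exact div_ne_zero (hne z hz) hmC
  have hd : ∀ z ∈ ball (0 : ℂ) 1, ‖deriv g₁ z‖ ≤ ‖deriv h₁ z‖ / 3 := fun z hz => by
    rw [hdh, hdg, norm_div, norm_div, div_right_comm]
    gcongr
    exact hdil z hz
  have hi : InjOn (fun z => h₁ z + conj (g₁ z)) (ball 0 1) := by
    intro z hz w hw he
    simp only [hf₁] at he
    exact hinj hz hw (sub_left_injective ((div_left_inj' hmC).1 he))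
  have hnorm : ∀ z, ‖h₁ z + conj (g₁ z)‖ = ‖f z - f 0‖ / m := fun z => by
    rw [hf₁, norm_div, norm_real, Real.norm_of_nonneg hmpos.le]
  have h10 : h₁ 0 = 0 := by simp [hh₁]
  have g10 : g₁ 0 = 0 := by simp [hg₁]
  have hlow := one_le_norm_deriv hah hag hn hd hi h10 g10 fun z hz => by
    rw [hnorm, one_le_div hmpos]
    exact hmin hz
  have hspos : 0 < Real.exp (-criticalWidth) / 2 := by positivity
  have hs1 : Real.exp (-criticalWidth) / 2 ≤ 1 := by
    have : Real.exp (-criticalWidth) ≤ 1 := Real.exp_le_one_iff.2 (by linarith [criticalWidth_pos])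
    linarith
  have hupp := norm_second_deriv_le_of_bounded hspos
    (hah.mono (ball_subset_ball hs1)) (hag.mono (ball_subset_ball hs1)) h10 g10 fun z hz =>
    norm_le_two_of_small hah hag hn hd hi h10 g10 (mem_sphere_zero_iff_norm.1 hz₁)
      (by rw [hnorm, div_self hmpos.ne']) (mem_ball_zero_iff.1 hz).le
  have hdd : deriv (deriv h₁) 0 = deriv (deriv h) 0 / m := by
    rw [show deriv h₁ = fun z => deriv h z / m from funext hdh]
    simp
  rw [hdd, norm_div, norm_real, Real.norm_of_nonneg hmpos.le, div_le_iff₀ hmpos] at hupp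
  rw [hdh, norm_div, norm_real, Real.norm_of_nonneg hmpos.le, one_le_div hmpos] at hlow
  exact hupp.trans (mul_le_mul_of_nonneg_left hlow coeffBound_pos.le)

end Distortion

end HarmonicBloch
-- Affine normalization, Schwarz's lemma and transfer to hyperbolic disks
namespace HarmonicBloch

/-- The Jacobian identity behind `f ↦ f - conj b * conj f`, which replaces `(h, g)` by `(h - conj b
* g, g - b * h)`. -/
lemma norm_sq_sub_norm_sq_affine (b x y : ℂ) :
    ‖x - conj b * y‖ ^ 2 - ‖y - b * x‖ ^ 2 = (1 - ‖b‖ ^ 2) * (‖x‖ ^ 2 - ‖y‖ ^ 2) := by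
  simp only [Complex.sq_norm, Complex.normSq_apply, sub_re, sub_im, mul_re, mul_im, conj_re,
    conj_im]
  ring

lemma deriv_comp_affine (F : ℂ → ℂ) (a c z : ℂ) :
    deriv (fun ζ => F (a + c * ζ)) z = c * deriv F (a + c * z) := by
  have := deriv_comp_mul_left c (fun w => F (a + w)) z
  rw [this, smul_eq_mul, deriv_comp_const_add]

lemma deriv_deriv_comp_affine (F : ℂ → ℂ) (a c : ℂ) :
    deriv (deriv fun ζ => F (a + c * ζ)) 0 = c * (c * deriv (deriv F) a) := by
  rw [show deriv (fun ζ => F (a + c * ζ)) = fun z => c * deriv F (a + c * z) from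
    funext fun z => deriv_comp_affine F a c z, deriv_const_mul_field, deriv_comp_affine,
    mul_zero, add_zero]

section SensePreservingInjective

variable {h g : ℂ → ℂ}

/-- The dilatation `ω = g' / h'` vanishes at `0`, so `|ω z| ≤ |z|`. Restricting to `|z| < 1/3`
reaches the case of dilatation at most `1/3`, at the cost of the factor `3`; and `g''(0) = ω'(0)
h'(0)`. -/
lemma norm_second_deriv_le_of_schwarz (hh : AnalyticOnNhd ℂ h (ball 0 1))
    (hg : AnalyticOnNhd ℂ g (ball 0 1))
    (hlt : ∀ z ∈ ball (0 : ℂ) 1, ‖deriv g z‖ < ‖deriv h z‖)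
    (hinj : InjOn (fun z => h z + conj (g z)) (ball 0 1)) (hg0 : deriv g 0 = 0) :
    ‖deriv (deriv h) 0‖ ≤ 3 * coeffBound * ‖deriv h 0‖ ∧
      ‖deriv (deriv g) 0‖ ≤ ‖deriv h 0‖ := by
  have hne : ∀ z ∈ ball (0 : ℂ) 1, deriv h z ≠ 0 := fun z hz =>
    norm_pos_iff.1 ((norm_nonneg _).trans_lt (hlt z hz))
  have h0m : (0 : ℂ) ∈ ball (0 : ℂ) 1 := mem_ball_self one_pos
  set ω : ℂ → ℂ := fun z => deriv g z / deriv h z with hω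
  have hωd : DifferentiableOn ℂ ω (ball 0 1) :=
    hg.deriv.differentiableOn.div hh.deriv.differentiableOn hne
  have hω0 : ω 0 = 0 := by simp [hω, hg0]
  have hωm : MapsTo ω (ball 0 1) (closedBall (ω 0) 1) := fun z hz => by
    rw [hω0, mem_closedBall_zero_iff, hω]
    simp only [norm_div]
    exact div_le_one_of_le₀ (hlt z hz).le (norm_nonneg _)
  have hschwarz : ∀ z ∈ ball (0 : ℂ) 1, ‖ω z‖ ≤ ‖z‖ := fun z hz => by
    have := dist_le_div_mul_dist_of_mapsTo_ball hωd hωm hz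
    simpa [hω0] using this
  have hω' : ‖deriv ω 0‖ ≤ 1 := by
    simpa using norm_deriv_le_div_of_mapsTo_ball hωd hωm one_pos
  have hgω : ∀ z ∈ ball (0 : ℂ) 1, deriv g z = ω z * deriv h z := fun z hz =>
    (div_mul_cancel₀ _ (hne z hz)).symm
  constructor
  · have hthird : ∀ z ∈ ball (0 : ℂ) 1, 0 + (1 / 3 : ℂ) * z ∈ ball (0 : ℂ) 1 ∧
        ‖0 + (1 / 3 : ℂ) * z‖ ≤ 1 / 3 := fun z hz => by
      have hz1 := mem_ball_zero_iff.1 hz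
      have : ‖0 + (1 / 3 : ℂ) * z‖ = 1 / 3 * ‖z‖ := by simp
      rw [mem_ball_zero_iff, this]
      constructor <;> linarith
    have han : ∀ F : ℂ → ℂ, AnalyticOnNhd ℂ F (ball 0 1) →
        AnalyticOnNhd ℂ (fun z => F (0 + (1 / 3 : ℂ) * z)) (ball 0 1) := fun F hF z hz =>
      (hF _ (hthird z hz).1).comp (f := fun z => 0 + (1 / 3 : ℂ) * z) (by fun_prop)
    have key := norm_second_deriv_le (han h hh) (han g hg) ?_ ?_ ?_
    · rw [deriv_deriv_comp_affine, deriv_comp_affine] at key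
      simp only [mul_zero, add_zero, norm_mul, norm_div, norm_one, Complex.norm_ofNat] at key
      linarith
    · intro z hz
      rw [deriv_comp_affine]
      exact mul_ne_zero (by norm_num) (hne _ (hthird z hz).1)
    · intro z hz
      have hm := hthird z hz
      rw [deriv_comp_affine, deriv_comp_affine, hgω _ hm.1, norm_mul, norm_mul, norm_mul]
      have := (hschwarz _ hm.1).trans hm.2
      calc _ ≤ ‖(1 / 3 : ℂ)‖ * (1 / 3 * ‖deriv h (0 + 1 / 3 * z)‖) := by gcongr
        _ = _ := by ring
    · intro z hz w hw he
      have := hinj (hthird z hz).1 (hthird w hw).1 he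
      simpa using this
  · have hev : deriv g =ᶠ[𝓝 0] fun z => ω z * deriv h z := by
      filter_upwards [isOpen_ball.mem_nhds h0m] with z hz using hgω z hz
    have hωat : DifferentiableAt ℂ ω 0 := hωd.differentiableAt (isOpen_ball.mem_nhds h0m)
    rw [hev.deriv_eq, deriv_fun_mul hωat (hh.deriv 0 h0m).differentiableAt, hω0, zero_mul,
      add_zero, norm_mul]
    exact mul_le_of_le_one_left (norm_nonneg _) hω'

/-- Bound for the pre-Schwarzian at the origin of `h + ε g`, for an injective sense-preserving
harmonic mapping `h + conj g` of the disk. -/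
theorem norm_preSchwarzian_le (hh : AnalyticOnNhd ℂ h (ball 0 1))
    (hg : AnalyticOnNhd ℂ g (ball 0 1))
    (hlt : ∀ z ∈ ball (0 : ℂ) 1, ‖deriv g z‖ < ‖deriv h z‖)
    (hinj : InjOn (fun z => h z + conj (g z)) (ball 0 1)) {ε : ℂ} (hε : ‖ε‖ ≤ 1) :
    ‖deriv (deriv h) 0 + ε * deriv (deriv g) 0‖ ≤
      (3 * coeffBound + 1) * ‖deriv h 0 + ε * deriv g 0‖ := by
  have h0m : (0 : ℂ) ∈ ball (0 : ℂ) 1 := mem_ball_self one_pos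
  have hpos : 0 < ‖deriv h 0‖ := (norm_nonneg _).trans_lt (hlt 0 h0m)
  set b : ℂ := deriv g 0 / deriv h 0 with hb
  have hb1 : ‖b‖ < 1 := by
    rw [hb, norm_div, div_lt_one hpos]
    exact hlt 0 h0m
  have hbsq : 0 < 1 - ‖b‖ ^ 2 := by nlinarith [norm_nonneg b]
  set h₁ : ℂ → ℂ := fun z => h z - conj b * g z with hh₁
  set g₁ : ℂ → ℂ := fun z => g z - b * h z with hg₁
  have hah : AnalyticOnNhd ℂ h₁ (ball 0 1) := fun z hz =>
    (hh z hz).sub (analyticAt_const.mul (hg z hz))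
  have hag : AnalyticOnNhd ℂ g₁ (ball 0 1) := fun z hz =>
    (hg z hz).sub (analyticAt_const.mul (hh z hz))
  have hdh : ∀ z ∈ ball (0 : ℂ) 1, deriv h₁ z = deriv h z - conj b * deriv g z := fun z hz =>
    ((hh z hz).differentiableAt.hasDerivAt.sub
      ((hg z hz).differentiableAt.hasDerivAt.const_mul _)).deriv
  have hdg : ∀ z ∈ ball (0 : ℂ) 1, deriv g₁ z = deriv g z - b * deriv h z := fun z hz =>
    ((hg z hz).differentiableAt.hasDerivAt.sub
      ((hh z hz).differentiableAt.hasDerivAt.const_mul _)).deriv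
  have hhd := (hh.deriv 0 h0m).differentiableAt.hasDerivAt
  have hgd := (hg.deriv 0 h0m).differentiableAt.hasDerivAt
  have hddh : deriv (deriv h₁) 0 = deriv (deriv h) 0 - conj b * deriv (deriv g) 0 := by
    have : deriv h₁ =ᶠ[𝓝 0] fun z => deriv h z - conj b * deriv g z := by
      filter_upwards [isOpen_ball.mem_nhds h0m] with z hz using hdh z hz
    rw [this.deriv_eq]
    exact (hhd.sub (hgd.const_mul _)).deriv
  have hddg : deriv (deriv g₁) 0 = deriv (deriv g) 0 - b * deriv (deriv h) 0 := by
    have : deriv g₁ =ᶠ[𝓝 0] fun z => deriv g z - b * deriv h z := by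
      filter_upwards [isOpen_ball.mem_nhds h0m] with z hz using hdg z hz
    rw [this.deriv_eq]
    exact (hgd.sub (hhd.const_mul _)).deriv
  have hg10 : deriv g₁ 0 = 0 := by
    rw [hdg 0 h0m, hb, div_mul_cancel₀ _ (norm_pos_iff.1 hpos), sub_self]
  have hlt₁ : ∀ z ∈ ball (0 : ℂ) 1, ‖deriv g₁ z‖ < ‖deriv h₁ z‖ := fun z hz => by
    rw [hdh z hz, hdg z hz]
    refine lt_of_pow_lt_pow_left₀ 2 (norm_nonneg _) ?_
    have h1 := norm_sq_sub_norm_sq_affine b (deriv h z) (deriv g z)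
    have h2 : 0 < ‖deriv h z‖ ^ 2 - ‖deriv g z‖ ^ 2 := by
      nlinarith [hlt z hz, norm_nonneg (deriv g z)]
    nlinarith [mul_pos hbsq h2]
  have hinj₁ : InjOn (fun z => h₁ z + conj (g₁ z)) (ball 0 1) := by
    intro z hz w hw he
    refine hinj hz hw ?_
    simp only [hh₁, hg₁, map_sub, map_mul] at he
    -- Equal values of the new map make the difference of the old values a fixed point of `x ↦ conj
    -- b * conj x`, a contraction since `|b| < 1`.
    have e : (h z + conj (g z)) - (h w + conj (g w)) =
        conj b * conj ((h z + conj (g z)) - (h w + conj (g w))) := by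
      simp only [map_sub, map_add, conj_conj]
      linear_combination he
    have e2 := congrArg norm e
    rw [norm_mul, RCLike.norm_conj, RCLike.norm_conj] at e2
    refine sub_eq_zero.1 (norm_eq_zero.1 ?_)
    nlinarith [norm_nonneg ((h z + conj (g z)) - (h w + conj (g w)))]
  obtain ⟨k1, k2⟩ := norm_second_deriv_le_of_schwarz hah hag hlt₁ hinj₁ hg10
  -- The disk automorphism estimate `|(ε + conj b) / (1 + ε b)| ≤ 1`; it makes the bound uniform in
  -- `b`.
  have hε1 : ‖ε + conj b‖ ≤ ‖1 + ε * b‖ := by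
    have h1 := norm_sq_sub_norm_sq_affine (-conj b) 1 ε
    have e1 : (1 : ℂ) - conj (-conj b) * ε = 1 + ε * b := by simp; ring
    have e2 : ε - (-conj b) * 1 = ε + conj b := by ring
    rw [e1, e2, norm_neg, RCLike.norm_conj, norm_one] at h1
    refine (sq_le_sq₀ (norm_nonneg _) (norm_nonneg _)).1 ?_
    have h2 : 0 ≤ 1 ^ 2 - ‖ε‖ ^ 2 := by nlinarith [norm_nonneg ε]
    nlinarith [mul_nonneg hbsq.le h2]
  have hbb : ((1 - ‖b‖ ^ 2 : ℝ) : ℂ) = 1 - b * conj b := by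
    rw [Complex.mul_conj, Complex.normSq_eq_norm_sq]; push_cast; rfl
  have hn : ‖((1 - ‖b‖ ^ 2 : ℝ) : ℂ)‖ = 1 - ‖b‖ ^ 2 := by
    rw [norm_real, Real.norm_of_nonneg hbsq.le]
  -- Inverting the affine change: `(1 - |b|²)(h + ε g) = (1 + ε b) h₁ + (ε + conj b) g₁`,
  -- differentiated once and twice at `0`.
  have hd1 : ((1 - ‖b‖ ^ 2 : ℝ) : ℂ) * (deriv h 0 + ε * deriv g 0) =
      (1 + ε * b) * deriv h₁ 0 := by
    have : (1 + ε * b) * deriv h₁ 0 = (1 + ε * b) * deriv h₁ 0 + (ε + conj b) * deriv g₁ 0 := by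
      rw [hg10]; ring
    rw [this, hbb, hdh 0 h0m, hdg 0 h0m]
    ring
  have hd2 : ((1 - ‖b‖ ^ 2 : ℝ) : ℂ) * (deriv (deriv h) 0 + ε * deriv (deriv g) 0) =
      (1 + ε * b) * deriv (deriv h₁) 0 + (ε + conj b) * deriv (deriv g₁) 0 := by
    rw [hbb, hddh, hddg]
    ring
  have n1 := congrArg norm hd1
  have n2 := congrArg norm hd2
  rw [norm_mul, hn, norm_mul] at n1
  rw [norm_mul, hn] at n2
  have n3 : (1 - ‖b‖ ^ 2) * ‖deriv (deriv h) 0 + ε * deriv (deriv g) 0‖ ≤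
      (1 - ‖b‖ ^ 2) * ((3 * coeffBound + 1) * ‖deriv h 0 + ε * deriv g 0‖) := by
    calc _ ≤ ‖1 + ε * b‖ * ‖deriv (deriv h₁) 0‖ + ‖ε + conj b‖ * ‖deriv (deriv g₁) 0‖ := by
          rw [n2]
          refine (norm_add_le _ _).trans_eq ?_
          rw [norm_mul, norm_mul]
      _ ≤ ‖1 + ε * b‖ * (3 * coeffBound * ‖deriv h₁ 0‖) + ‖1 + ε * b‖ * ‖deriv h₁ 0‖ := by
          gcongr
      _ = (3 * coeffBound + 1) * (‖1 + ε * b‖ * ‖deriv h₁ 0‖) := by ring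
      _ = _ := by rw [← n1]; ring
  exact le_of_mul_le_mul_left n3 hbsq

end SensePreservingInjective

lemma ball_subset_hyperbolicDisk {a : ℂ} (ha : ‖a‖ < 1) {ρ : ℝ} :
    ball a (Real.tanh ρ * (1 - ‖a‖)) ⊆ hyperbolicDisk a ρ := by
  intro z hz
  rw [mem_ball, dist_eq_norm] at hz
  have ht : Real.tanh ρ < 1 := Real.tanh_lt_one ρ
  have hz1 : ‖z‖ < 1 := by
    have := norm_le_norm_sub_add z a
    nlinarith
  have hden : 1 - ‖a‖ ≤ ‖1 - conj a * z‖ := by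
    have h1 := norm_sub_norm_le 1 (conj a * z)
    rw [norm_one, norm_mul, RCLike.norm_conj] at h1
    nlinarith [norm_nonneg a]
  have hpos : 0 < ‖1 - conj a * z‖ := by linarith
  refine ⟨mem_ball_zero_iff.2 hz1, ?_⟩
  rw [norm_div, div_lt_iff₀ hpos]
  have h0 : 0 < Real.tanh ρ := by
    by_contra! hle
    nlinarith [norm_nonneg (z - a)]
  nlinarith

/-- The pre-Schwarzian of `H + ε G` is uniformly bounded for a sense-preserving ULU mapping
`H + conj G`. -/
theorem exists_bound_preSchwarzian {H G : ℂ → ℂ} (hH : AnalyticOnNhd ℂ H (ball 0 1))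
    (hG : AnalyticOnNhd ℂ G (ball 0 1))
    (hlt : ∀ z ∈ ball (0 : ℂ) 1, ‖deriv G z‖ < ‖deriv H z‖) {ρ : ℝ} (hρ : 0 < ρ)
    (hinj : ∀ a ∈ ball (0 : ℂ) 1, InjOn (fun z => H z + conj (G z)) (hyperbolicDisk a ρ))
    {ε : ℂ} (hε : ‖ε‖ ≤ 1) :
    ∃ C : ℝ, 0 ≤ C ∧ ∀ a ∈ ball (0 : ℂ) 1,
      (1 - ‖a‖ ^ 2) * ‖deriv (deriv H) a + ε * deriv (deriv G) a‖ ≤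
        C * ‖deriv H a + ε * deriv G a‖ := by
  have ht : 0 < Real.tanh ρ := by
    rw [Real.tanh_eq_sinh_div_cosh]
    exact div_pos (Real.sinh_pos_iff.2 hρ) (Real.cosh_pos ρ)
  have hC := coeffBound_pos
  refine ⟨2 * (3 * coeffBound + 1) / Real.tanh ρ, by positivity, fun a ha => ?_⟩
  have ha1 := mem_ball_zero_iff.1 ha
  set R : ℝ := Real.tanh ρ * (1 - ‖a‖) with hR
  have hRpos : 0 < R := mul_pos ht (by linarith)
  have hRn : ‖(R : ℂ)‖ = R := by rw [norm_real, Real.norm_of_nonneg hRpos.le]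
  have hmem : ∀ z ∈ ball (0 : ℂ) 1, a + R * z ∈ hyperbolicDisk a ρ := fun z hz => by
    refine ball_subset_hyperbolicDisk ha1 ?_
    rw [mem_ball, dist_eq_norm, add_sub_cancel_left, norm_mul, hRn]
    exact mul_lt_of_lt_one_right hRpos (mem_ball_zero_iff.1 hz)
  have han : ∀ F : ℂ → ℂ, AnalyticOnNhd ℂ F (ball 0 1) →
      AnalyticOnNhd ℂ (fun z => F (a + R * z)) (ball 0 1) := fun F hF z hz =>
    (hF _ (hmem z hz).1).comp (f := fun z => a + R * z) (by fun_prop)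
  have key := norm_preSchwarzian_le (han H hH) (han G hG) ?_ ?_ hε
  · rw [deriv_deriv_comp_affine, deriv_deriv_comp_affine, deriv_comp_affine, deriv_comp_affine, mul_zero, add_zero,
      show (R : ℂ) * (R * deriv (deriv H) a) + ε * (R * (R * deriv (deriv G) a)) =
        R * (R * (deriv (deriv H) a + ε * deriv (deriv G) a)) by ring,
      show (R : ℂ) * deriv H a + ε * (R * deriv G a) = R * (deriv H a + ε * deriv G a) by ring,
      norm_mul, norm_mul, norm_mul, hRn] at key
    have k2 : R * ‖deriv (deriv H) a + ε * deriv (deriv G) a‖ ≤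
        (3 * coeffBound + 1) * ‖deriv H a + ε * deriv G a‖ :=
      le_of_mul_le_mul_left (key.trans_eq (by ring)) hRpos
    -- This is `1 - |a|² ≤ 2 (1 - |a|)`.
    have e1 : (1 - ‖a‖ ^ 2) ≤ 2 / Real.tanh ρ * R := by
      rw [hR]
      field_simp
      nlinarith [norm_nonneg a]
    calc _ ≤ 2 / Real.tanh ρ * R * ‖deriv (deriv H) a + ε * deriv (deriv G) a‖ := by gcongr
      _ = 2 / Real.tanh ρ * (R * ‖deriv (deriv H) a + ε * deriv (deriv G) a‖) := by ring
      _ ≤ 2 / Real.tanh ρ * ((3 * coeffBound + 1) * ‖deriv H a + ε * deriv G a‖) := by gcongr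
      _ = _ := by ring
  · intro z hz
    rw [deriv_comp_affine, deriv_comp_affine, norm_mul, norm_mul]
    exact mul_lt_mul_of_pos_left (hlt _ (hmem z hz).1) (by rwa [hRn])
  · intro z hz w hw he
    have := hinj a ha (hmem z hz) (hmem w hw) he
    simpa [hRpos.ne'] using this

/-- A nonvanishing analytic function on the unit disk has an analytic logarithm. -/
lemma exists_analytic_log {F : ℂ → ℂ} (hF : AnalyticOnNhd ℂ F (ball 0 1))
    (hne : ∀ z ∈ ball (0 : ℂ) 1, F z ≠ 0) :
    ∃ h : ℂ → ℂ, AnalyticOnNhd ℂ h (ball (0 : ℂ) 1) ∧ ∀ z ∈ ball (0 : ℂ) 1, exp (h z) = F z := by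
  have h0m : (0 : ℂ) ∈ ball (0 : ℂ) 1 := mem_ball_self one_pos
  obtain ⟨L, hL⟩ := (hF.deriv.differentiableOn.div hF.differentiableOn hne).isExactOn_ball
  set h : ℂ → ℂ := fun z => L z - L 0 + log (F 0) with hh
  have hhd : ∀ z ∈ ball (0 : ℂ) 1, HasDerivAt h (deriv F z / F z) z := fun z hz =>
    ((hL z hz).sub_const _).add_const _
  refine ⟨h, DifferentiableOn.analyticOnNhd
    (fun z hz => (hhd z hz).differentiableAt.differentiableWithinAt) isOpen_ball, ?_⟩
  -- With `h' = F' / F`, the product `F * exp (-h)` is constant, and the choice of `h 0` makes the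
  -- constant `1`.
  have hd : ∀ z ∈ ball (0 : ℂ) 1, HasDerivAt (fun z => F z * exp (-h z)) 0 z := fun z hz => by
    refine ((hF z hz).differentiableAt.hasDerivAt.mul (hhd z hz).neg.cexp).congr_deriv ?_
    have := hne z hz
    field_simp
    ring
  intro z hz
  have hc := isOpen_ball.is_const_of_deriv_eq_zero (convex_ball (0 : ℂ) 1).isPreconnected
    (fun w hw => (hd w hw).differentiableAt.differentiableWithinAt)
    (fun w hw => (hd w hw).deriv) hz h0m
  have h00 : h 0 = log (F 0) := by simp [hh]
  rw [h00, exp_neg, exp_neg, exp_log (hne 0 h0m), mul_inv_cancel₀ (hne 0 h0m)] at hc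
  exact ((mul_inv_eq_one₀ (exp_ne_zero _)).1 hc).symm

end HarmonicBloch

/-! ### The main theorem -/

theorem theorem1 (F H G : ℂ → ℂ)
    (hH : AnalyticOnNhd ℂ H (ball (0 : ℂ) 1))
    (hG : AnalyticOnNhd ℂ G (ball (0 : ℂ) 1))
    (hF : ∀ z ∈ ball (0 : ℂ) 1, F z = H z + conj (G z))
    (hsp : HarmonicBloch.SensePreserving F)
    (hulu : HarmonicBloch.IsULU F)
    (ε : ℂ) (hε : ‖ε‖ ≤ 1) :
    (∃ h : ℂ → ℂ, AnalyticOnNhd ℂ h (ball (0 : ℂ) 1) ∧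
      ∀ z ∈ ball (0 : ℂ) 1, exp (h z) = deriv H z + ε * deriv G z) ∧
    ∀ h g ω : ℂ → ℂ,
      AnalyticOnNhd ℂ h (ball (0 : ℂ) 1) →
      AnalyticOnNhd ℂ g (ball (0 : ℂ) 1) →
      (∀ z ∈ ball (0 : ℂ) 1, exp (h z) = deriv H z + ε * deriv G z) →
      (∀ z ∈ ball (0 : ℂ) 1, deriv g z = ω z * deriv h z) →
      (∃ M : ℝ, ∀ z ∈ ball (0 : ℂ) 1, ‖ω z‖ ≤ M) →
      (fun z => h z + conj (g z)) ∈ HarmonicBloch.blochType 1 := by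
  have hlt : ∀ z ∈ ball (0 : ℂ) 1, ‖deriv G z‖ < ‖deriv H z‖ := by
    intro z hz
    have hev : F =ᶠ[𝓝 z] fun z => H z + conj (G z) := by
      filter_upwards [isOpen_ball.mem_nhds hz] with w hw using hF w hw
    have hj := hsp z hz
    have e : HarmonicBloch.jacobian F z =
        HarmonicBloch.jacobian (fun z => H z + conj (G z)) z := by
      simp only [HarmonicBloch.jacobian, HarmonicBloch.dz, HarmonicBloch.dzbar, hev.fderiv_eq]
    rw [e, HarmonicBloch.jacobian_add_conj (hH z hz) (hG z hz)] at hj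
    exact lt_of_pow_lt_pow_left₀ 2 (norm_nonneg _) (by linarith)
  have hne : ∀ z ∈ ball (0 : ℂ) 1, deriv H z + ε * deriv G z ≠ 0 := by
    intro z hz he
    have h1 := congrArg norm (eq_neg_of_add_eq_zero_left he)
    rw [norm_neg, norm_mul] at h1
    nlinarith [hlt z hz, norm_nonneg (deriv G z)]
  refine ⟨HarmonicBloch.exists_analytic_log
    (hH.deriv.add (analyticOnNhd_const.mul hG.deriv)) hne, ?_⟩
  rintro h g ω hh hg hexp hω ⟨M, hM⟩
  refine ⟨HarmonicBloch.isHarmonicMapping_add_conj hh hg, ?_⟩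
  obtain ⟨-, ρ, hρ, hinj⟩ := hulu
  obtain ⟨C, hC0, hC⟩ := HarmonicBloch.exists_bound_preSchwarzian hH hG hlt hρ
    (fun a ha => (hinj a ha).congr fun z hz => hF z hz.1) hε
  have hM0 : 0 ≤ M := (norm_nonneg _).trans (hM 0 (mem_ball_self one_pos))
  refine ⟨(1 + M) * C, ?_⟩
  rintro _ ⟨z, hz, rfl⟩
  have hz1 := mem_ball_zero_iff.1 hz
  -- Differentiating `exp h = H' + ε G'` identifies `h'` with the pre-Schwarzian.
  have hd : exp (h z) * deriv h z = deriv (deriv H) z + ε * deriv (deriv G) z := by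
    have hev : (fun z => exp (h z)) =ᶠ[𝓝 z] fun z => deriv H z + ε * deriv G z := by
      filter_upwards [isOpen_ball.mem_nhds hz] with w hw using hexp w hw
    have h1 := (hh z hz).differentiableAt.hasDerivAt.cexp
    have h2 := (hH.deriv z hz).differentiableAt.hasDerivAt.add
      ((hG.deriv z hz).differentiableAt.hasDerivAt.const_mul ε)
    exact (h1.congr_of_eventuallyEq hev.symm).unique h2
  have hpos : 0 < 1 - ‖z‖ ^ 2 := by nlinarith [norm_nonneg z]
  have hbound : (1 - ‖z‖ ^ 2) * ‖deriv h z‖ ≤ C := by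
    have k := hC z hz
    rw [← hd, ← hexp z hz, norm_mul] at k
    have he : 0 < ‖exp (h z)‖ := norm_pos_iff.2 (exp_ne_zero _)
    exact le_of_mul_le_mul_left ((by ring : _ = _).trans_le (k.trans_eq (mul_comm _ _))) he
  -- `|J_f|` is at most `max(1, M²) |h'|²`, hence at most `(1 + M)² |h'|²`, whether or not `f` is
  -- sense-preserving.
  have hJ : √|HarmonicBloch.jacobian (fun z => h z + conj (g z)) z| ≤ (1 + M) * ‖deriv h z‖ := by
    rw [HarmonicBloch.jacobian_add_conj (hh z hz) (hg z hz)]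
    refine Real.sqrt_le_iff.2 ⟨by positivity, ?_⟩
    have h1 : ‖deriv g z‖ ≤ M * ‖deriv h z‖ := by
      rw [hω z hz, norm_mul]
      exact mul_le_mul_of_nonneg_right (hM z hz) (norm_nonneg _)
    have h2 : ‖deriv g z‖ ^ 2 ≤ (M * ‖deriv h z‖) ^ 2 := pow_le_pow_left₀ (norm_nonneg _) h1 2
    have h3 : 0 ≤ M * ‖deriv h z‖ ^ 2 := by positivity
    rw [abs_le]
    constructor <;> nlinarith [sq_nonneg ‖deriv h z‖, sq_nonneg ‖deriv g z‖,
      sq_nonneg (M * ‖deriv h z‖)]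
  simp only [Real.rpow_one]
  calc _ ≤ (1 - ‖z‖ ^ 2) * ((1 + M) * ‖deriv h z‖) := by gcongr
    _ = (1 + M) * ((1 - ‖z‖ ^ 2) * ‖deriv h z‖) := by ring
    _ ≤ (1 + M) * C := by gcongr
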